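/- Let $n\ge 1$. For $a,b\in\mathbb{C}$, an open set $D\subset\mathbb{C}^n$ and a holomorphic function $f$ on $D$, say that $(f,D)$ has property $\mathbf{P}_{a,b}$ if $$\prod_{i=1}^{n}\left(\frac{\partial f}{\partial z_i}(z)-a\right)\left(\frac{\partial f}{\partial z_i}(z)-b\right)\left(\frac{\partial f}{\partial z_i}(z)-f(z)\right)\neq 0\qquad\text{for all } z\in D.$$ (i) Let $a\neq b$ be fixed complex numbers. If $f$ is entire on $\mathbb{C}^n$ and $(f,\mathbb{C}^n)$ has property $\mathbf{P}_{a,b}$, then $f$ is constant. (ii) For $r>0$ let $D^n(0,r)=\{z\in\mathbb{C}^n: |z_i|<r \text{ for } i=1,\dots,n\}$. For all sufficiently small $r>0$ the polydisc $D^n(0,r)$ does not meet the hyperplane $\{z_1+\dots+z_n=1\}$. For every $r>0$ such that $D^n(0,r)$ does not meet this hyperplane, each function $f_m(z)=m(z_1+\dots+z_n)$, $m\in\mathbb{N}$, $m\ge 3$, is holomorphic on $D^n(0,r)$ and $(f_m,D^n(0,r))$ has property $\mathbf{P}_{1,2}$, but the family $\{f_m: m\geq 3\}$ is not normal in $D^n(0,r)$: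 it is not true that each sequence in the family has a subsequence converging locally uniformly in $D^n(0,r)$, even if locally uniform convergence to $\infty$ is also admitted. (iii) Consequently Bloch's principle fails in $\mathbb{C}^n$ for the property $\mathbf{P}_{1,2}$: every entire function $f$ such that $(f,\mathbb{C}^n)$ has $\mathbf{P}_{1,2}$ is constant, but it is not true that for every domain $D\subset\mathbb{C}^n$ each family of holomorphic functions $f$ on $D$ such that $(f,D)$ has $\mathbf{P}_{1,2}$ is normal in $D$ (with locally uniform convergence to $\infty$ admitted). -/

import Mathlib

open Set Filter Topology

/-- The complex partial derivative `∂f/∂z_i` at `z`. -/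
noncomputable def partialDeriv {n : ℕ} (i : Fin n) (f : (Fin n → ℂ) → ℂ) (z : Fin n → ℂ) : ℂ :=
  fderiv ℂ f z (Pi.single i 1)

/-- The expression `P(f)(z) = ∏_i (∂f/∂z_i - a) (∂f/∂z_i - b) (∂f/∂z_i - f)`. -/
noncomputable def blochProduct {n : ℕ} (a b : ℂ) (f : (Fin n → ℂ) → ℂ) (z : Fin n → ℂ) : ℂ :=
  ∏ i : Fin n, (partialDeriv i f z - a) * (partialDeriv i f z - b) * (partialDeriv i f z - f z)

/-- `(f, D) ∈ P`: the function `P(f)` omits the value zero on `D`. -/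
def HasPropertyP {n : ℕ} (a b : ℂ) (f : (Fin n → ℂ) → ℂ) (D : Set (Fin n → ℂ)) : Prop :=
  ∀ z ∈ D, blochProduct a b f z ≠ 0

/-- The open polydisc of radius `r` centred at the origin. -/
def polydisc (n : ℕ) (r : ℝ) : Set (Fin n → ℂ) :=
  {z | ∀ i, ‖z i‖ < r}

/-- The function `f_m(z) = m (z_1 + ⋯ + z_n)`. -/
noncomputable def linearFamily (n : ℕ) (m : ℕ) (z : Fin n → ℂ) : ℂ :=
  (m : ℂ) * ∑ i, z i

/-- Each sequence in `F` has a subsequence that converges locally uniformly in `D`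
(to a complex-valued function). -/
def IsNormalFamily {n : ℕ} (F : Set ((Fin n → ℂ) → ℂ)) (D : Set (Fin n → ℂ)) : Prop :=
  ∀ u : ℕ → (Fin n → ℂ) → ℂ, (∀ k, u k ∈ F) →
    ∃ φ : ℕ → ℕ, StrictMono φ ∧
      ∃ g : (Fin n → ℂ) → ℂ, TendstoLocallyUniformlyOn (fun k => u (φ k)) g atTop D

/-- Normality in the wider sense, in which `∞` is also admitted as a locally uniform limit:
each sequence in `F` has a subsequence that either converges locally uniformly in `D` to a
complex-valued function or tends to `∞` uniformly on the compact subsets of `D`. -/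
def IsNormalFamilyWide {n : ℕ} (F : Set ((Fin n → ℂ) → ℂ)) (D : Set (Fin n → ℂ)) : Prop :=
  ∀ u : ℕ → (Fin n → ℂ) → ℂ, (∀ k, u k ∈ F) →
    ∃ φ : ℕ → ℕ, StrictMono φ ∧
      ((∃ g : (Fin n → ℂ) → ℂ, TendstoLocallyUniformlyOn (fun k => u (φ k)) g atTop D) ∨
        ∀ K ⊆ D, IsCompact K → ∀ M : ℝ, ∀ᶠ k in atTop, ∀ z ∈ K, M < ‖u (φ k) z‖)

/-- Bloch's principle for a property `Q` of functions on subsets of `ℂⁿ`: if every entire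
function with the property `Q` on `ℂⁿ` is constant, then every family of holomorphic functions
with the property `Q` in a domain `D` is normal in `D`. Normality is taken in the wider sense,
so that a failure of the principle is not merely due to sequences tending to `∞`. -/
def BlochPrinciple {n : ℕ} (Q : ((Fin n → ℂ) → ℂ) → Set (Fin n → ℂ) → Prop) : Prop :=
  (∀ f : (Fin n → ℂ) → ℂ, Differentiable ℂ f → Q f univ → ∃ c : ℂ, ∀ z, f z = c) →
    ∀ D : Set (Fin n → ℂ), IsOpen D → IsConnected D →
      ∀ F : Set ((Fin n → ℂ) → ℂ), (∀ f ∈ F, DifferentiableOn ℂ f D ∧ Q f D) →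
        IsNormalFamilyWide F D

/-!
The heart of the matter is the one-variable little Picard theorem, proved here in the classical
way of Landau and König. An entire function `f` omitting `±1` is `cos ∘ G` with `G` entire, since
`f + i √(1 - f²)` has no zeros. Applying this twice, `f = cos (π cos H)`, and `H` omits all
points where `cos` takes an integer value. These points meet every disc of radius `6`
(`Complex.exists_cos_eq_int`). On the other hand, the range of a nonconstant entire function contains
discs of every radius, which is a weak form of Bloch's theorem
(`Complex.exists_ball_subset_range`). So `H`, and with it `f`, is constant.

For an entire `f` on `ℂⁿ` with the property `P_{a,b}`, restrict `f` to a line parallel to the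
`i`-th axis. The restriction `h` is entire, `h'` omits `a` and `b`, hence is a constant `c`, and
`h s = h 0 + c s`. If `c ≠ 0`, then `h` takes the value `c = h'`, which the third factor forbids.
So all partial derivatives vanish (`HasPropertyP.fderiv_eq_zero`).

The functions `m (z₁ + ⋯ + zₙ)` have constant partial derivatives `m`, so they have the property
`P_{1,2}` off the hyperplane `z₁ + ⋯ + zₙ = 1` as soon as `m ≥ 3`. They vanish at the origin and
tend to infinity at every point with nonzero coordinate sum, so no subsequence converges to a
finite limit at every point of the polydisc, and none tends to infinity at every point.
-/

/-! ### Discs in the range of an entire function -/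

/-- If `‖g'‖` is at most twice its value at the centre of a disc, then `g` is close to its linear
part on a disc one sixth of the size, and so covers a disc of proportional radius. -/
theorem Complex.ball_subset_range_of_norm_deriv_le {g : ℂ → ℂ} (hg : Differentiable ℂ g)
    {c : ℂ} {s : ℝ} (hs : 0 < s) (hc : deriv g c ≠ 0)
    (hbound : ∀ w ∈ Metric.ball c s, ‖deriv g w‖ ≤ 2 * ‖deriv g c‖) :
    Metric.ball (g c) (‖deriv g c‖ * s / 24) ⊆ range g := by
  set A := ‖deriv g c‖ with hA
  have hApos : 0 < A := norm_pos_iff.mpr hc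
  have hmaps : MapsTo (deriv g) (Metric.ball c s) (Metric.closedBall (deriv g c) (3 * A)) := by
    intro w hw
    rw [mem_closedBall_iff_norm]
    linarith [norm_sub_le (deriv g w) (deriv g c), hbound w hw]
  have hclose : ∀ w ∈ Metric.closedBall c (s / 6), ‖deriv g w - deriv g c‖ ≤ A / 2 := by
    intro w hw
    have hw' : w ∈ Metric.ball c s := Metric.closedBall_subset_ball (by linarith) hw
    -- The Schwarz lemma for `g'` turns the bound `3 * A` into one proportional to the distance.
    have hschwarz := Complex.dist_le_div_mul_dist_of_mapsTo_ball hg.deriv.differentiableOn hmaps hw'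
    rw [dist_eq_norm] at hschwarz
    calc _ ≤ 3 * A / s * dist w c := hschwarz
      _ ≤ 3 * A / s * (s / 6) := by
        have := Metric.mem_closedBall.mp hw
        gcongr
      _ = A / 2 := by field_simp; ring
  have hsphere : ∀ w ∈ Metric.sphere c (s / 6), A * s / 12 ≤ ‖g w - g c‖ := by
    intro w hw
    have hd : ∀ x ∈ Metric.closedBall c (s / 6),
        HasDerivWithinAt (fun x => g x - deriv g c * x) (deriv g x - deriv g c)
          (Metric.closedBall c (s / 6)) x := by
      intro x _
      simpa using ((hg x).hasDerivAt.fun_sub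
        ((hasDerivAt_id x).const_mul (deriv g c))).hasDerivWithinAt
    have hmv := (convex_closedBall c (s / 6)).norm_image_sub_le_of_norm_hasDerivWithin_le hd hclose
      (Metric.mem_closedBall_self (by positivity)) (Metric.sphere_subset_closedBall hw)
    have hwn : ‖w - c‖ = s / 6 := mem_sphere_iff_norm.mp hw
    have htri := norm_sub_norm_le (deriv g c * (w - c)) (-((g w - deriv g c * w) -
      (g c - deriv g c * c)))
    rw [norm_neg, norm_mul, hwn] at htri
    rw [hwn] at hmv
    have heq : deriv g c * (w - c) - -((g w - deriv g c * w) - (g c - deriv g c * c))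
        = g w - g c := by ring
    rw [heq] at htri
    linarith
  have hfreq : ∃ᶠ w in 𝓝 c, g w ≠ g c := by
    intro h
    apply hc
    have hev : g =ᶠ[𝓝 c] fun _ => g c := h.mono fun w hw => not_not.mp hw
    rw [hev.deriv_eq, deriv_const]
  have hcover := hg.diffContOnCl.ball_subset_image_closedBall (r := s / 6) (by positivity)
    hsphere hfreq
  rw [show A * s / 24 = A * s / 12 / 2 by ring]
  exact hcover.trans (image_subset_range _ _)

/-- A weak form of Bloch's theorem: the range of an entire function with a nonzero derivative
somewhere contains discs of every radius. -/
theorem Complex.exists_ball_subset_range {g : ℂ → ℂ} (hg : Differentiable ℂ g) {z₀ : ℂ}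
    (hz₀ : deriv g z₀ ≠ 0) {R : ℝ} (hR : 0 < R) : ∃ w, Metric.ball w R ⊆ range g := by
  have hB : 0 < ‖deriv g z₀‖ := norm_pos_iff.mpr hz₀
  obtain ⟨ρ, hρ⟩ : ∃ ρ, ρ = 48 * R / ‖deriv g z₀‖ := ⟨_, rfl⟩
  have hρpos : 0 < ρ := by rw [hρ]; positivity
  -- Weighting `‖g'‖` with the distance to the boundary makes its maximum point `c` interior, and
  -- bounds `‖g'‖` by `2 * ‖g' c‖` on the disc around `c` of half the distance to the boundary.
  obtain ⟨c, hc, hmax⟩ := (isCompact_closedBall z₀ ρ).exists_isMaxOn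
    ⟨z₀, Metric.mem_closedBall_self hρpos.le⟩
    (f := fun z => (ρ - dist z z₀) * ‖deriv g z‖)
    (by have := hg.deriv.continuous; fun_prop)
  have hmax₀ : ρ * ‖deriv g z₀‖ ≤ (ρ - dist c z₀) * ‖deriv g c‖ := by
    simpa using hmax (Metric.mem_closedBall_self hρpos.le)
  have hd₀ : 0 ≤ ρ - dist c z₀ := sub_nonneg.mpr hc
  have hprod : 0 < (ρ - dist c z₀) * ‖deriv g c‖ := lt_of_lt_of_le (by positivity) hmax₀
  have hd : 0 < ρ - dist c z₀ := pos_of_mul_pos_left hprod (norm_nonneg _)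
  have hc0 : 0 < ‖deriv g c‖ := pos_of_mul_pos_right hprod hd₀
  refine ⟨g c, (Metric.ball_subset_ball ?_).trans (Complex.ball_subset_range_of_norm_deriv_le hg
    (s := (ρ - dist c z₀) / 2) (by positivity) (norm_pos_iff.mp hc0) ?_)⟩
  · have : ρ * ‖deriv g z₀‖ = 48 * R := by rw [hρ]; field_simp
    linarith
  · intro w hw
    have hw' := Metric.mem_ball.mp hw
    have htri := dist_triangle w c z₀
    have hwρ : w ∈ Metric.closedBall z₀ ρ := Metric.mem_closedBall.mpr (by linarith)
    have hle : (ρ - dist w z₀) * ‖deriv g w‖ ≤ (ρ - dist c z₀) * ‖deriv g c‖ := hmax hwρ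
    have hle' : (ρ - dist c z₀) / 2 * ‖deriv g w‖ ≤ (ρ - dist w z₀) * ‖deriv g w‖ := by
      gcongr
      linarith
    refine le_of_mul_le_mul_left ?_ hd
    linarith

/-! ### Entire logarithms and inverse cosines -/

theorem Complex.exists_exp_eq {u : ℂ → ℂ} (hu : Differentiable ℂ u) (h0 : ∀ z, u z ≠ 0) :
    ∃ L : ℂ → ℂ, Differentiable ℂ L ∧ ∀ z, Complex.exp (L z) = u z := by
  have hq : Differentiable ℂ fun z => deriv u z / u z := hu.deriv.fun_div hu h0
  obtain ⟨L, hL0, hL⟩ := hq.isExactOn_univ.with_val_at 0 (Complex.log (u 0))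
  have hL' : ∀ z, HasDerivAt L (deriv u z / u z) z := fun z => hL z (mem_univ z)
  refine ⟨L, fun z => (hL' z).differentiableAt, fun z => ?_⟩
  have hderiv : ∀ z, HasDerivAt (fun z => u z * Complex.exp (-L z)) 0 z := by
    intro z
    refine ((hu z).hasDerivAt.mul (hL' z).neg.cexp).congr_deriv ?_
    have := h0 z
    field_simp
    ring
  have hconst := is_const_of_deriv_eq_zero (fun z => (hderiv z).differentiableAt)
    (fun z => (hderiv z).deriv) z 0
  simp only [hL0, Complex.exp_neg, Complex.exp_log (h0 0), mul_inv_cancel₀ (h0 0)] at hconst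
  exact (eq_of_div_eq_one (by rw [div_eq_mul_inv, hconst])).symm

theorem Complex.exists_cos_eq {f : ℂ → ℂ} (hf : Differentiable ℂ f) (h1 : ∀ z, f z ≠ 1)
    (h2 : ∀ z, f z ≠ -1) : ∃ G : ℂ → ℂ, Differentiable ℂ G ∧ ∀ z, Complex.cos (G z) = f z := by
  obtain ⟨L, hLd, hL⟩ := Complex.exists_exp_eq (u := fun z => (1 - f z) * (1 + f z))
    (by fun_prop) fun z => mul_ne_zero (sub_ne_zero.mpr (h1 z).symm)
      fun h => h2 z (eq_neg_of_add_eq_zero_right h)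
  have hsq : ∀ z, Complex.exp (L z / 2) ^ 2 = 1 - f z ^ 2 := by
    intro z
    rw [← Complex.exp_nat_mul, Nat.cast_ofNat, mul_div_cancel₀ _ two_ne_zero, hL]
    ring
  have hprod : ∀ z, (f z + Complex.I * Complex.exp (L z / 2)) *
      (f z - Complex.I * Complex.exp (L z / 2)) = 1 := by
    intro z
    linear_combination hsq z - Complex.exp (L z / 2) ^ 2 * Complex.I_sq
  obtain ⟨M, hMd, hM⟩ := Complex.exists_exp_eq
    (u := fun z => f z + Complex.I * Complex.exp (L z / 2)) (by fun_prop)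
    fun z => left_ne_zero_of_mul_eq_one (hprod z)
  refine ⟨fun z => -Complex.I * M z, by fun_prop, fun z => ?_⟩
  have hexp : Complex.exp (-M z) = f z - Complex.I * Complex.exp (L z / 2) := by
    rw [Complex.exp_neg, hM]
    exact inv_eq_of_mul_eq_one_right (hprod z)
  have e1 : -Complex.I * M z * Complex.I = M z := by
    linear_combination -M z * Complex.I_sq
  rw [Complex.cos, neg_mul (-Complex.I * M z), e1, hM, hexp]
  ring

/-! ### The little Picard theorem -/

/-- The solutions of `cos w = n`, `n` an integer, form a `6`-net in the plane: they include
`2 π k ± i y` whenever `cosh y` is an integer, and a step of `2` away from `0` at least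
doubles `cosh`. -/
theorem Complex.exists_cos_eq_int (w : ℂ) :
    ∃ v ∈ Metric.ball w 6, ∃ n : ℤ, Complex.cos v = n := by
  obtain ⟨y, hy, n, hn⟩ : ∃ y : ℝ, |y - w.im| ≤ 2 ∧ ∃ n : ℤ, Real.cosh y = n := by
    have key : ∀ x : ℝ, 0 ≤ x → ∃ y : ℝ, |y - x| ≤ 2 ∧ ∃ n : ℤ, Real.cosh y = n := by
      intro x hx
      have h2 : 2 ≤ Real.cosh 2 := by
        rw [Real.cosh_eq]
        linarith [Real.quadratic_le_exp_of_nonneg (x := 2) (by norm_num), Real.exp_pos (-2)]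
      have hstep : Real.cosh x + 1 ≤ Real.cosh (x + 2) := by
        rw [Real.cosh_add]
        have := mul_nonneg (Real.sinh_nonneg_iff.mpr hx) (Real.sinh_nonneg_iff.mpr zero_le_two)
        nlinarith [Real.one_le_cosh x]
      obtain ⟨y, hy, hyn⟩ := intermediate_value_Icc (by linarith : x ≤ x + 2)
        Real.continuous_cosh.continuousOn
        ⟨Int.le_ceil (Real.cosh x), (Int.ceil_lt_add_one _).le.trans hstep⟩
      exact ⟨y, abs_le.mpr ⟨by linarith [hy.1], by linarith [hy.2]⟩, _, hyn⟩
    rcases le_total 0 w.im with h | h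
    · exact key _ h
    · obtain ⟨y, hy, n, hn⟩ := key (-w.im) (by linarith)
      refine ⟨-y, ?_, n, by rwa [Real.cosh_neg]⟩
      rwa [← abs_neg, show -(-y - w.im) = y - -w.im by ring]
  set k : ℤ := round (w.re / (2 * Real.pi)) with hk
  have hx : |(k : ℝ) * (2 * Real.pi) - w.re| ≤ Real.pi := by
    have h := abs_sub_round (w.re / (2 * Real.pi))
    rw [← hk, abs_sub_comm] at h
    have hpi := Real.pi_pos
    calc _ = |((k : ℝ) - w.re / (2 * Real.pi)) * (2 * Real.pi)| := by
          congr 1; field_simp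
      _ = |(k : ℝ) - w.re / (2 * Real.pi)| * (2 * Real.pi) := by
          rw [abs_mul, abs_of_pos (by positivity : 0 < 2 * Real.pi)]
      _ ≤ 1 / 2 * (2 * Real.pi) := by gcongr
      _ = Real.pi := by ring
  refine ⟨y * Complex.I + k * (2 * Real.pi), ?_, n, ?_⟩
  · rw [mem_ball_iff_norm]
    refine (Complex.norm_le_abs_re_add_abs_im _).trans_lt ?_
    have hre : ((y : ℂ) * Complex.I + k * (2 * Real.pi) - w).re = k * (2 * Real.pi) - w.re := by
      simp
    have him : ((y : ℂ) * Complex.I + k * (2 * Real.pi) - w).im = y - w.im := by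
      simp
    rw [hre, him]
    linarith [Real.pi_lt_four]
  · rw [Complex.cos_add_int_mul_two_pi, Complex.cos_mul_I, ← Complex.ofReal_cosh, hn,
      Complex.ofReal_intCast]

/-- The little Picard theorem: an entire function that omits two values is constant. -/
theorem Complex.exists_eq_const_of_forall_ne {f : ℂ → ℂ} (hf : Differentiable ℂ f)
    {a b : ℂ} (hab : a ≠ b) (ha : ∀ z, f z ≠ a) (hb : ∀ z, f z ≠ b) : ∃ c, ∀ z, f z = c := by
  have hba : b - a ≠ 0 := sub_ne_zero.mpr hab.symm
  -- An affine change of variable moves the omitted values to `-1` and `1`.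
  have hone : ∀ z, (2 * f z - a - b) / (b - a) ≠ 1 := fun z h =>
    hb z (by rw [div_eq_iff hba] at h; linear_combination h / 2)
  have hneg : ∀ z, (2 * f z - a - b) / (b - a) ≠ -1 := fun z h =>
    ha z (by rw [div_eq_iff hba] at h; linear_combination h / 2)
  obtain ⟨G, hGd, hG⟩ := Complex.exists_cos_eq
    (f := fun z => (2 * f z - a - b) / (b - a)) (by fun_prop) hone hneg
  have hpi : (Real.pi : ℂ) ≠ 0 := Complex.ofReal_ne_zero.mpr Real.pi_ne_zero
  -- At a multiple of `π` the cosine is `±1`, so `G` avoids these multiples.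
  have hGint : ∀ z, ∀ n : ℤ, G z / Real.pi ≠ n := by
    intro z n h
    rw [div_eq_iff hpi] at h
    have hsin : Complex.sin (G z) = 0 := by rw [h, Complex.sin_int_mul_pi]
    have hcs := Complex.sin_sq_add_cos_sq (G z)
    rw [hsin, zero_pow two_ne_zero, zero_add, hG] at hcs
    rcases sq_eq_one_iff.mp hcs with h' | h'
    · exact hone z h'
    · exact hneg z h'
  obtain ⟨H, hHd, hH⟩ := Complex.exists_cos_eq (f := fun z => G z / Real.pi)
    (by fun_prop) (fun z => by simpa using hGint z 1) (fun z => by simpa using hGint z (-1))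
  have hH' : ∀ z, deriv H z = 0 := by
    intro z
    by_contra hz
    obtain ⟨w, hw⟩ := Complex.exists_ball_subset_range hHd hz (R := 6) (by norm_num)
    obtain ⟨v, hv, n, hn⟩ := Complex.exists_cos_eq_int w
    obtain ⟨x, rfl⟩ := hw hv
    exact hGint x n (by rw [← hH, hn])
  have hHc := is_const_of_deriv_eq_zero hHd hH'
  refine ⟨f 0, fun z => ?_⟩
  have hGz : G z = G 0 := by
    have := (hH z).symm.trans ((congrArg Complex.cos (hHc z 0)).trans (hH 0))
    exact (div_left_inj' hpi).mp this
  have := (hG z).symm.trans ((congrArg Complex.cos hGz).trans (hG 0))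
  have := (div_left_inj' hba).mp this
  linear_combination this / 2

/-! ### Entire functions with the property `P_{a,b}` -/

theorem HasPropertyP.ne {n : ℕ} {a b : ℂ} {f : (Fin n → ℂ) → ℂ} {D : Set (Fin n → ℂ)}
    (h : HasPropertyP a b f D) {z : Fin n → ℂ} (hz : z ∈ D) (i : Fin n) :
    partialDeriv i f z ≠ a ∧ partialDeriv i f z ≠ b ∧ partialDeriv i f z ≠ f z := by
  have hi := Finset.prod_ne_zero_iff.mp (h z hz) i (Finset.mem_univ i)
  simpa [sub_eq_zero, and_assoc] using hi

/-- In one variable: if `h'` omits two values and `h'` never agrees with `h`, then `h' = 0`. The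
little Picard theorem makes `h` affine, and a nonconstant affine function takes every value. -/
theorem Complex.deriv_eq_zero_of_omits {h : ℂ → ℂ} (hd : Differentiable ℂ h) {a b : ℂ}
    (hab : a ≠ b) (ha : ∀ s, deriv h s ≠ a) (hb : ∀ s, deriv h s ≠ b)
    (hh : ∀ s, deriv h s ≠ h s) (s : ℂ) : deriv h s = 0 := by
  obtain ⟨c, hc⟩ := Complex.exists_eq_const_of_forall_ne hd.deriv hab ha hb
  rw [hc]
  by_contra hc0
  have hd' : ∀ s, HasDerivAt (fun s => h s - c * s) 0 s := fun s => by
    simpa [hc] using (hd s).hasDerivAt.fun_sub ((hasDerivAt_id s).const_mul c)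
  have hconst := is_const_of_deriv_eq_zero (fun s => (hd' s).differentiableAt)
    (fun s => (hd' s).deriv) ((c - h 0) / c) 0
  rw [mul_div_cancel₀ _ hc0] at hconst
  refine hh ((c - h 0) / c) ?_
  rw [hc]
  linear_combination -hconst

theorem HasPropertyP.fderiv_eq_zero {n : ℕ} {a b : ℂ} (hab : a ≠ b) {f : (Fin n → ℂ) → ℂ}
    (hf : Differentiable ℂ f) (h : HasPropertyP a b f univ) (z : Fin n → ℂ) :
    fderiv ℂ f z = 0 := by
  have hpartial : ∀ i, partialDeriv i f z = 0 := by
    intro i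
    have hline : ∀ s : ℂ, HasDerivAt (fun s : ℂ => f (z + s • Pi.single i 1))
        (partialDeriv i f (z + s • Pi.single i 1)) s := by
      intro s
      refine (hf _).hasFDerivAt.comp_hasDerivAt s ?_
      simpa using ((hasDerivAt_id s).smul_const (Pi.single i (1 : ℂ))).const_add z
    have h0 := Complex.deriv_eq_zero_of_omits (fun s => (hline s).differentiableAt) hab
      (fun s => by rw [(hline s).deriv]; exact (h.ne (mem_univ _) i).1)
      (fun s => by rw [(hline s).deriv]; exact (h.ne (mem_univ _) i).2.1)
      (fun s => by rw [(hline s).deriv]; exact (h.ne (mem_univ _) i).2.2) 0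
    simpa [(hline 0).deriv] using h0
  ext v
  rw [← Finset.univ_sum_single v, map_sum]
  refine Finset.sum_eq_zero fun i _ => ?_
  rw [← mul_one (v i), ← smul_eq_mul, Pi.single_smul, map_smul]
  exact smul_eq_zero_of_right _ (hpartial i)

theorem HasPropertyP.exists_eq_const {n : ℕ} {a b : ℂ} (hab : a ≠ b) {f : (Fin n → ℂ) → ℂ}
    (hf : Differentiable ℂ f) (h : HasPropertyP a b f univ) : ∃ c, ∀ z, f z = c :=
  ⟨f 0, fun z => is_const_of_fderiv_eq_zero hf (h.fderiv_eq_zero hab hf) z 0⟩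

/-! ### The linear family on polydiscs -/

theorem hasFDerivAt_linearFamily (n m : ℕ) (z : Fin n → ℂ) :
    HasFDerivAt (linearFamily n m)
      ((m : ℂ) • ∑ i, ContinuousLinearMap.proj (R := ℂ) (φ := fun _ : Fin n => ℂ) i) z :=
  (HasFDerivAt.fun_sum fun i _ => hasFDerivAt_apply i z).const_mul (m : ℂ)

theorem partialDeriv_linearFamily (n m : ℕ) (i : Fin n) (z : Fin n → ℂ) :
    partialDeriv i (linearFamily n m) z = m := by
  simp [partialDeriv, (hasFDerivAt_linearFamily n m z).fderiv, Pi.single_apply]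

theorem hasPropertyP_linearFamily {n m : ℕ} (hm : 3 ≤ m) {D : Set (Fin n → ℂ)}
    (hD : {z : Fin n → ℂ | ∑ i, z i = 1} ∩ D = ∅) : HasPropertyP 1 2 (linearFamily n m) D := by
  intro z hz
  refine Finset.prod_ne_zero_iff.mpr fun i _ => ?_
  have hsum : (1 : ℂ) - ∑ i, z i ≠ 0 := fun h =>
    (eq_empty_iff_forall_notMem.mp hD) z ⟨(sub_eq_zero.mp h).symm, hz⟩
  rw [partialDeriv_linearFamily, linearFamily, ← mul_one_sub]
  refine mul_ne_zero (mul_ne_zero ?_ ?_) (mul_ne_zero (by norm_cast; lia) hsum)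
  · exact sub_ne_zero.mpr (by norm_cast; lia)
  · exact sub_ne_zero.mpr (by norm_cast; lia)

theorem hyperplane_inter_polydisc_eq_empty {n : ℕ} {r : ℝ} (hr : n * r < 1) :
    {z : Fin n → ℂ | ∑ i, z i = 1} ∩ polydisc n r = ∅ := by
  refine eq_empty_iff_forall_notMem.mpr fun z ⟨hz, hzr⟩ => ?_
  have hle : ‖∑ i, z i‖ ≤ n * r := by
    simpa using norm_sum_le_of_le Finset.univ fun i _ => (hzr i).le
  rw [show ∑ i, z i = 1 from hz, norm_one] at hle
  linarith

theorem polydisc_eq_ball (n : ℕ) {r : ℝ} (hr : 0 < r) : polydisc n r = Metric.ball 0 r := by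
  ext z
  simp [polydisc, pi_norm_lt_iff hr]

theorem IsNormalFamily.isNormalFamilyWide {n : ℕ} {F : Set ((Fin n → ℂ) → ℂ)}
    {D : Set (Fin n → ℂ)} (h : IsNormalFamily F D) : IsNormalFamilyWide F D := fun u hu =>
  let ⟨φ, hφ, hg⟩ := h u hu
  ⟨φ, hφ, Or.inl hg⟩

theorem not_isNormalFamilyWide_linearFamily {n : ℕ} (hn : 1 ≤ n) {r : ℝ} (hr : 0 < r) :
    ¬ IsNormalFamilyWide {f | ∃ m : ℕ, 3 ≤ m ∧ f = linearFamily n m} (polydisc n r) := by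
  intro h
  obtain ⟨φ, hφ, hlim⟩ := h (fun k => linearFamily n (k + 3)) fun k => ⟨k + 3, by lia, rfl⟩
  rcases hlim with ⟨g, hg⟩ | hinf
  · -- At a point with coordinate sum `r / 2` the values grow without bound.
    set z : Fin n → ℂ := Pi.single ⟨0, hn⟩ ((r / 2 : ℝ) : ℂ) with hz
    have hzmem : z ∈ polydisc n r := by
      rw [polydisc_eq_ball n hr, mem_ball_zero_iff, hz, Pi.norm_single, Complex.norm_real,
        Real.norm_of_nonneg (by positivity)]
      linarith
    have hval : ∀ k, ‖linearFamily n (φ k + 3) z‖ = ((φ k + 3 : ℕ) : ℝ) * (r / 2) := by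
      intro k
      rw [linearFamily, hz, Finset.sum_pi_single', if_pos (Finset.mem_univ _), norm_mul,
        Complex.norm_natCast, Complex.norm_real, Real.norm_of_nonneg (by positivity)]
    have htop : Tendsto (fun k => ‖linearFamily n (φ k + 3) z‖) atTop atTop := by
      simp_rw [hval]
      have hφ3 : Tendsto (fun k => φ k + 3) atTop atTop :=
        tendsto_atTop_mono (fun k => Nat.le_add_right _ _) hφ.tendsto_atTop
      exact ((tendsto_natCast_atTop_atTop (R := ℝ)).comp hφ3).atTop_mul_const (by positivity)
    exact not_tendsto_nhds_of_tendsto_atTop htop _ (hg.tendsto_at hzmem).norm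
  · -- At the origin all functions vanish.
    have h0 : ({0} : Set (Fin n → ℂ)) ⊆ polydisc n r := by
      simpa [polydisc] using fun _ => hr
    obtain ⟨k, hk⟩ := (hinf {0} h0 isCompact_singleton 0).exists
    simpa [linearFamily] using hk 0 rfl

theorem proposition1 (n : ℕ) (hn : 1 ≤ n) :
    (∀ a b : ℂ, a ≠ b → ∀ f : (Fin n → ℂ) → ℂ, Differentiable ℂ f →
      HasPropertyP a b f Set.univ → ∃ c : ℂ, ∀ z, f z = c) ∧
    (∃ r₀ : ℝ, 0 < r₀ ∧ ∀ r : ℝ, 0 < r → r ≤ r₀ →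
      {z : Fin n → ℂ | ∑ i, z i = 1} ∩ polydisc n r = ∅) ∧
    (∀ r : ℝ, 0 < r → {z : Fin n → ℂ | ∑ i, z i = 1} ∩ polydisc n r = ∅ →
      (∀ m : ℕ, 3 ≤ m → DifferentiableOn ℂ (linearFamily n m) (polydisc n r) ∧
        HasPropertyP 1 2 (linearFamily n m) (polydisc n r)) ∧
      ¬ IsNormalFamily {f | ∃ m : ℕ, 3 ≤ m ∧ f = linearFamily n m} (polydisc n r) ∧
      ¬ IsNormalFamilyWide {f | ∃ m : ℕ, 3 ≤ m ∧ f = linearFamily n m} (polydisc n r)) ∧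
    ¬ BlochPrinciple (n := n) (HasPropertyP 1 2) := by
  have hdiff : ∀ (m : ℕ) (D : Set (Fin n → ℂ)), DifferentiableOn ℂ (linearFamily n m) D :=
    fun m D z _ => (hasFDerivAt_linearFamily n m z).differentiableAt.differentiableWithinAt
  have hr₀ : (0 : ℝ) < 1 / (n + 1) := by positivity
  have hempty : ∀ r : ℝ, r ≤ 1 / (n + 1) →
      {z : Fin n → ℂ | ∑ i, z i = 1} ∩ polydisc n r = ∅ := by
    intro r hr
    refine hyperplane_inter_polydisc_eq_empty ?_
    calc (n : ℝ) * r ≤ n * (1 / (n + 1)) := by gcongr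
      _ < 1 := by rw [mul_one_div, div_lt_one (by positivity)]; linarith
  refine ⟨fun a b hab f hf h => h.exists_eq_const hab hf, ⟨_, hr₀, fun r _ hr => hempty r hr⟩,
    fun r hr hD => ⟨fun m hm => ⟨hdiff m _, hasPropertyP_linearFamily hm hD⟩,
      fun h => not_isNormalFamilyWide_linearFamily hn hr h.isNormalFamilyWide,
      not_isNormalFamilyWide_linearFamily hn hr⟩, fun hBloch => ?_⟩
  refine not_isNormalFamilyWide_linearFamily hn hr₀
    (hBloch (fun f hf h => h.exists_eq_const (by norm_num) hf) _ ?_ ?_ _ ?_)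
  · rw [polydisc_eq_ball n hr₀]
    exact Metric.isOpen_ball
  · rw [polydisc_eq_ball n hr₀]
    exact (convex_ball _ _).isConnected (Metric.nonempty_ball.mpr hr₀)
  · rintro _ ⟨m, hm, rfl⟩
    exact ⟨hdiff m _, hasPropertyP_linearFamily hm (hempty _ le_rfl)⟩
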